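/- Let $k\ge 2$ and $1\le j\le k-1$ be integers. A $k$-uniform hypergraph $H=(V,E)$ consists of a finite vertex set $V$ and a set $E$ of $k$-element subsets of $V$; it is $F$-free if it contains no (not necessarily induced) copy of $F$. Write $[k]=\{1,\dots,k\}$, and let $[k]^{(j)}$ be the set of all $j$-element subsets of $[k]$. Let $d\in[0,1]$ and $\eta>0$. (a) For a $j$-uniform hypergraph $G$ on $V$, let $\mathcal K_k(G)$ be the set of all $k$-element subsets of $V$ all of whose $j$-element subsets are edges of $G$. A $k$-uniform hypergraph $H=(V,E)$ is *$(d,\eta,j)$-dense* if for every $j$-uniform hypergraph $G$ with vertex set $V$ $$|\mathcal K_k(G)\cap E|\ \ge\ d\,|\mathcal K_k(G)|-\eta\,|V|^k .$$ (b) Let $\mathscr S$ be a set of subsets of $[k]$. For a family $\mathscr G=\{G_S : S\in\mathscr S\}$ with $G_S\subseteq V^S$ (a set of functions $S\to V$), let $\mathcal K_k(\mathscr G)$ be the set of all $k$-tuples $v=(v_1,\dots,v_k)\in V^k$ with $v|_S\in G_S$ for all $S\in\mathscr S$, and let $e_H(\mathscr G)$ be the number of $v\in\mathcal K_k(\mathscr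 G)$ with $\{v_1,\dots,v_k\}\in E$. A $k$-uniform hypergraph $H=(V,E)$ is *$(d,\eta,\mathscr S)$-dense* if for every such family $$e_H(\mathscr G)\ \ge\ d\,|\mathcal K_k(\mathscr G)|-\eta\,|V|^k .$$ For a $k$-uniform hypergraph $F$, let $\pi_j(F)$ (respectively $\pi_{\mathscr S}(F)$) be the supremum of all $d\in[0,1]$ such that for every $\eta>0$ and every $n\in\mathbb N$ there is a $k$-uniform, $F$-free, $(d,\eta,j)$-dense (respectively $(d,\eta,\mathscr S)$-dense) hypergraph $H$ with $|V(H)|\ge n$; the supremum of the empty set is taken to be $0$. **Proposition.** For every $k$-uniform hypergraph $F$ and every integer $j$ with $1\le j\le k-1$, $$\pi_j(F)=\pi_{[k]^{(j)}}(F).$$ -/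

import Mathlib

/-- A `k`-uniform hypergraph with vertex set `V`: a set of `k`-element subsets of `V`. -/
@[ext]
structure UniformHypergraph (k : ℕ) (V : Type*) where
  /-- The edges. -/
  edges : Finset (Finset V)
  /-- Every edge has exactly `k` elements. -/
  card_of_mem : ∀ e ∈ edges, e.card = k

namespace UniformHypergraph

/-- `F.Free H`: the hypergraph `H` contains no copy of `F` as a (not necessarily induced)
subhypergraph. -/
def Free {k : ℕ} {V W : Type*} (F : UniformHypergraph k V) (H : UniformHypergraph k W) : Prop :=
  ¬ ∃ f : V ↪ W, ∀ e ∈ F.edges, e.map f ∈ H.edges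

open Classical in
/-- `G.cliques k` is the collection of `k`-element subsets of the vertex set all of whose
`j`-element subsets are edges of the `j`-uniform hypergraph `G`. -/
noncomputable def cliques {j : ℕ} {V : Type*} [Fintype V] (G : UniformHypergraph j V) (k : ℕ) :
    Finset (Finset V) :=
  {s ∈ Finset.powersetCard k Finset.univ | Finset.powersetCard j s ⊆ G.edges}

open Classical in
/-- `H` is `(d, η, j)`-dense, the density being measured with respect to the `k`-cliques of
arbitrary `j`-uniform hypergraphs `G` on the vertex set of `H`. -/
def IsDense {k : ℕ} {V : Type*} [Fintype V] (H : UniformHypergraph k V) (d η : ℝ) (j : ℕ) : Prop :=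
  ∀ G : UniformHypergraph j V,
    d * ((G.cliques k).card : ℝ) - η * (Fintype.card V : ℝ) ^ k
      ≤ ((G.cliques k ∩ H.edges).card : ℝ)

/-- The generalised Turán density `π_j(F)`. The set of admissible densities is bounded by `1`.
It is empty only if `F` has no edges, and then its supremum within `[0, 1]` is `0`, which is also
the value of `sSup` on the empty set of reals. -/
noncomputable def turanDensity {k : ℕ} {V : Type*} (F : UniformHypergraph k V) (j : ℕ) : ℝ :=
  sSup {d : ℝ | d ∈ Set.Icc (0 : ℝ) 1 ∧ ∀ η : ℝ, 0 < η → ∀ n : ℕ,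
    ∃ (W : Type) (_ : Fintype W) (H : UniformHypergraph k W),
      F.Free H ∧ H.IsDense d η j ∧ n ≤ Fintype.card W}

open Classical in
/-- For a family `G` assigning to each `S ∈ 𝒮` (where `𝒮` is a set of subsets of the index set
`Fin k`) a set `G S` of functions `S → V`, this is the set of all `k`-tuples in `V` whose
restriction to `S` lies in `G S` for every `S ∈ 𝒮`. Tuples may have repeated entries. -/
noncomputable def tupleCliques {k : ℕ} {V : Type*} [Fintype V] {𝒮 : Finset (Finset (Fin k))}
    (G : (S : 𝒮) → Set (S.1 → V)) : Finset (Fin k → V) :=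
  {v | ∀ S : 𝒮, (fun i : S.1 => v i.1) ∈ G S}

open Classical in
/-- The set of those tuples `(v_1, …, v_k)` in `tupleCliques G` for which `{v_1, …, v_k}` is an
edge of `H`. -/
noncomputable def tupleEdges {k : ℕ} {V : Type*} [Fintype V] (H : UniformHypergraph k V)
    {𝒮 : Finset (Finset (Fin k))} (G : (S : 𝒮) → Set (S.1 → V)) : Finset (Fin k → V) :=
  {v ∈ tupleCliques G | Finset.univ.image v ∈ H.edges}

/-- `H` is `(d, η, 𝒮)`-dense, where `𝒮` is a set of subsets of the index set `Fin k`. -/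
def IsFamilyDense {k : ℕ} {V : Type*} [Fintype V] (H : UniformHypergraph k V) (d η : ℝ)
    (𝒮 : Finset (Finset (Fin k))) : Prop :=
  ∀ G : (S : 𝒮) → Set (S.1 → V),
    d * ((tupleCliques G).card : ℝ) - η * (Fintype.card V : ℝ) ^ k
      ≤ ((H.tupleEdges G).card : ℝ)

/-- The generalised Turán density `π_𝒮(F)`, with the same convention for the supremum as in
`turanDensity`. -/
noncomputable def familyTuranDensity {k : ℕ} {V : Type*} (F : UniformHypergraph k V)
    (𝒮 : Finset (Finset (Fin k))) : ℝ :=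
  sSup {d : ℝ | d ∈ Set.Icc (0 : ℝ) 1 ∧ ∀ η : ℝ, 0 < η → ∀ n : ℕ,
    ∃ (W : Type) (_ : Fintype W) (H : UniformHypergraph k W),
      F.Free H ∧ H.IsFamilyDense d η 𝒮 ∧ n ≤ Fintype.card W}

end UniformHypergraph

/-! A density notion tested on tuples controls one tested on sets: take each `G_S` to consist of the
functions whose image is an edge of `G`; each `k`-set comes from `k!` tuples
(`IsFamilyDense.isDense`). It remains to show that if `d` is admissible for `π_j`, then `d - ε` is
admissible for the family version.

For `j ≥ 2` the same hypergraph works. Given the family, colour the vertices with `k` colours and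
keep the `j`-sets that are rainbow and, listed by colour, lie in the family. As `j ≥ 2`, the
`k`-cliques of this graph are rainbow, so they correspond exactly to the correctly coloured tuples
of the family. Averaging over all colourings gives the bound for injective tuples; the others are
negligible (`IsDense.isFamilyDense`).

For `j = 1` cliques need not be rainbow, and one passes to an induced subhypergraph, which remains
`F`-free (`exists_subset_le_boxSum`). Split the vertices into many parts and shrink them to equal
linear size so that every `k` parts have nearly constant density on all large subboxes
(`exists_regular_subfamily`). By Ramsey's theorem some `t` parts have all their `k`-tuples of
density at least `d - ε`, or all below it. The latter would make the union of these parts too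
sparse; in the former case the union is dense on every box. -/

/-! ### Weak regularity for functions on boxes. -/

section BoxSums

open Classical

/-- The sum of `F` over the combinatorial box `∏ a, B a`. -/
noncomputable def boxSum {κ V : Type*} [Fintype κ] [DecidableEq κ] (F : (κ → V) → ℝ) (B : κ → Finset V) : ℝ :=
  ∑ v ∈ Fintype.piFinset B, F v

variable {κ V : Type*} [Fintype κ] [DecidableEq κ]

theorem boxSum_const (D : ℝ) (B : κ → Finset V) :
    boxSum (fun _ => D) B = D * ∏ a, ((B a).card : ℝ) := by
  simp [boxSum, Fintype.card_piFinset, mul_comm]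

theorem boxSum_sub_const (F : (κ → V) → ℝ) (D : ℝ) (B : κ → Finset V) :
    boxSum (fun v => F v - D) B = boxSum F B - D * ∏ a, ((B a).card : ℝ) := by
  rw [← boxSum_const]
  simp only [boxSum, Finset.sum_sub_distrib]

theorem boxSum_nonneg {F : (κ → V) → ℝ} (hF : ∀ v, 0 ≤ F v) (B : κ → Finset V) :
    0 ≤ boxSum F B :=
  Finset.sum_nonneg fun v _ => hF v

theorem boxSum_le_prod {F : (κ → V) → ℝ} (hF : ∀ v, F v ≤ 1) (B : κ → Finset V) :
    boxSum F B ≤ ∏ a, ((B a).card : ℝ) := by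
  have h : boxSum F B ≤ boxSum (fun _ => 1) B := Finset.sum_le_sum fun v _ => hF v
  simpa [boxSum_const] using h

theorem boxSum_eq_sum_fiber {β : Type*} [Fintype β] [DecidableEq β] (F : (κ → V) → ℝ) (A : κ → Finset V)
    (q : κ → V → β) :
    boxSum F A = ∑ p : κ → β, boxSum F (fun a => {x ∈ A a | q a x = p a}) := by
  unfold boxSum
  rw [← Finset.sum_fiberwise (Fintype.piFinset A) (fun v a => q a (v a))]
  refine Finset.sum_congr rfl fun p _ => Finset.sum_congr ?_ fun _ _ => rfl
  ext v
  simp [funext_iff, forall_and]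

theorem boxSum_update (F : (κ → V) → ℝ) (B : κ → Finset V) (i : κ) (C : Finset V) :
    boxSum F (Function.update B i C) = ∑ x ∈ C, boxSum F (Function.update B i {x}) := by
  unfold boxSum
  rw [← Finset.sum_fiberwise_of_maps_to (t := C) (g := fun v : κ → V => v i)]
  · refine Finset.sum_congr rfl fun x hx => Finset.sum_congr ?_ fun _ _ => rfl
    ext v
    simp only [Finset.mem_filter, Fintype.mem_piFinset]
    rw [Function.forall_update_iff B (p := fun a s => v a ∈ s),
      Function.forall_update_iff B (p := fun a s => v a ∈ s)]
    simp only [Finset.mem_singleton]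
    constructor
    · rintro ⟨⟨_, h⟩, e⟩
      exact ⟨e, h⟩
    · rintro ⟨e, h⟩
      exact ⟨⟨e ▸ hx, h⟩, e⟩
  · intro v hv
    simpa using Fintype.mem_piFinset.1 hv i

/-- Discard a largest element repeatedly: if the remaining sum were positive, some remaining value,
hence also the discarded one, would be positive. -/
theorem exists_subset_card_eq_sum_nonpos (f : V → ℝ) (s : ℕ) (B : Finset V) (hs : s ≤ B.card)
    (hB : ∑ x ∈ B, f x ≤ 0) : ∃ C ⊆ B, C.card = s ∧ ∑ x ∈ C, f x ≤ 0 := by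
  induction B using Finset.strongInduction with
  | H B ih =>
    rcases hs.eq_or_lt with h | h
    · exact ⟨B, subset_rfl, h.symm, hB⟩
    obtain ⟨x, hx, hmax⟩ := B.exists_max_image f (Finset.card_pos.1 (by omega))
    obtain ⟨C, hC, hc⟩ := ih (B.erase x) (Finset.erase_ssubset hx)
      (by rw [Finset.card_erase_of_mem hx]; omega) (by
        by_contra! hpos
        obtain ⟨y, hy, hy0⟩ := Finset.exists_lt_of_sum_lt (s := B.erase x) (f := fun _ => 0)
          (g := f) (by simpa using hpos)
        have := hmax y (Finset.mem_of_mem_erase hy)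
        have := Finset.add_sum_erase B f hx
        linarith)
    exact ⟨C, hC.trans (Finset.erase_subset _ _), hc⟩

/-- The box sum is additive in each side, so the sides can be shrunk one coordinate at a time. -/
theorem exists_subbox_card_eq_boxSum_nonpos (F : (κ → V) → ℝ) (s : ℕ) (B : κ → Finset V)
    (hs : ∀ a, s ≤ (B a).card) (hB : boxSum F B ≤ 0) :
    ∃ C : κ → Finset V, (∀ a, C a ⊆ B a) ∧ (∀ a, (C a).card = s) ∧ boxSum F C ≤ 0 := by
  have key : ∀ T : Finset κ, ∃ C : κ → Finset V, (∀ a, C a ⊆ B a) ∧ (∀ a ∈ T, (C a).card = s) ∧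
      (∀ a ∉ T, C a = B a) ∧ boxSum F C ≤ 0 := by
    intro T
    induction T using Finset.induction_on with
    | empty => exact ⟨B, fun _ => subset_rfl, by simp, by simp, hB⟩
    | insert i T hi ih =>
      obtain ⟨C, hCB, hCT, hC, hC0⟩ := ih
      rw [← Function.update_eq_self i C, boxSum_update] at hC0
      obtain ⟨D, hD, hDs, hD0⟩ := exists_subset_card_eq_sum_nonpos _ s (C i)
        (by rw [hC i hi]; exact hs i) hC0
      rw [← boxSum_update] at hD0
      refine ⟨Function.update C i D, fun a => ?_, fun a ha => ?_, fun a ha => ?_, hD0⟩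
      · rcases eq_or_ne a i with rfl | h
        · simpa using hD.trans (hCB a)
        · simpa [h] using hCB a
      · rcases eq_or_ne a i with rfl | h
        · simpa using hDs
        · simpa [h] using hCT a (Finset.mem_of_mem_insert_of_ne ha h)
      · have h : a ≠ i := fun h => ha (h ▸ Finset.mem_insert_self _ _)
        simpa [h] using hC a fun h' => ha (Finset.mem_insert_of_mem h')
  obtain ⟨C, h1, h2, _, h3⟩ := key Finset.univ
  exact ⟨C, h1, fun a => h2 a (Finset.mem_univ a), h3⟩

/-- Splitting every side into `B a` and its complement cuts the full box into `2 ^ |κ|` boxes with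
total sum zero; an excess on one must be offset by deficits on the others. Hence only deficits need
to be excluded to get regularity. -/
theorem boxSum_le_of_forall_subbox_ge (F : (κ → V) → ℝ) (A : κ → Finset V) (δ : ℝ) (hδ : 0 ≤ δ)
    (hA : boxSum F A = 0) (h : ∀ B : κ → Finset V, (∀ a, B a ⊆ A a) → -δ ≤ boxSum F B)
    (B : κ → Finset V) (hB : ∀ a, B a ⊆ A a) : boxSum F B ≤ 2 ^ Fintype.card κ * δ := by
  have e := boxSum_eq_sum_fiber F A (fun a x => decide (x ∈ B a))
  rw [hA, ← Finset.add_sum_erase _ _ (Finset.mem_univ fun _ => true)] at e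
  have hBA : (fun a => {x ∈ A a | decide (x ∈ B a) = true}) = B := by
    funext a
    ext x
    simpa using @hB a x
  beta_reduce at e
  rw [hBA] at e
  have hrest : ∑ p ∈ (Finset.univ : Finset (κ → Bool)).erase (fun _ => true), (-δ) ≤
      ∑ p ∈ (Finset.univ : Finset (κ → Bool)).erase (fun _ => true),
        boxSum F (fun a => {x ∈ A a | decide (x ∈ B a) = p a}) :=
    Finset.sum_le_sum fun p _ => h _ fun a => Finset.filter_subset _ _
  have hcard : (((Finset.univ : Finset (κ → Bool)).erase (fun _ => true)).card : ℝ) ≤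
      2 ^ Fintype.card κ := by
    have := Finset.card_le_card (Finset.erase_subset (fun _ => true)
      (Finset.univ : Finset (κ → Bool)))
    rw [Finset.card_univ, Fintype.card_fun, Fintype.card_bool] at this
    exact_mod_cast this
  rw [Finset.sum_const, nsmul_eq_mul] at hrest
  nlinarith

-- Density decrement: a subbox with a large deficit has long sides and density lower by at least
-- `γ`. Passing to it lowers the bound `M * γ` by one step and multiplies the size by about `γ`; at
-- `M = 0` the sum vanishes and `D = 0` works.
set_option maxHeartbeats 1000000 in
theorem exists_regular_subfamily_of_boxSum_le {ι : Type*} {F : (κ → V) → ℝ} (hF0 : ∀ v, 0 ≤ F v)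
    (hF1 : ∀ v, F v ≤ 1) (p : κ ↪ ι) {γ : ℝ} (hγ : 0 < γ) (hγ1 : γ ≤ 1) (M s : ℕ)
    (A : ι → Finset V) (hA : ∀ i, (A i).card = s)
    (hM : boxSum F (fun a => A (p a)) ≤ M * γ * (s : ℝ) ^ Fintype.card κ) :
    ∃ (s' : ℕ) (A' : ι → Finset V), γ ^ M * s ≤ s' ∧ (∀ i, A' i ⊆ A i) ∧ (∀ i, (A' i).card = s') ∧
      ∃ D : ℝ, ∀ B : κ → Finset V, (∀ a, B a ⊆ A' (p a)) →
        |boxSum (fun v => F v - D) B| ≤ 2 ^ Fintype.card κ * (γ * (s' : ℝ) ^ Fintype.card κ) := by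
  induction M generalizing s A with
  | zero =>
    refine ⟨s, A, by simp, fun _ => subset_rfl, hA, 0, fun B hB => ?_⟩
    have h : boxSum F B ≤ boxSum F (fun a => A (p a)) :=
      Finset.sum_le_sum_of_subset_of_nonneg (Fintype.piFinset_subset _ _ hB) fun v _ _ => hF0 v
    have h0 := boxSum_nonneg hF0 B
    simp only [Nat.cast_zero, zero_mul] at hM
    simp only [sub_zero, abs_of_nonneg h0]
    refine (h.trans hM).trans (by positivity)
  | succ M ih =>
    set N : ℝ := (s : ℝ) ^ Fintype.card κ with hN
    have hN0 : 0 ≤ N := by positivity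
    set D : ℝ := boxSum F (fun a => A (p a)) / N with hD
    have hprod : ∏ a, ((A (p a)).card : ℝ) = N := by simp [hA, hN]
    have hle : boxSum F (fun a => A (p a)) ≤ N := hprod ▸ boxSum_le_prod hF1 _
    have hDN : D * N = boxSum F (fun a => A (p a)) := by
      rcases hN0.eq_or_lt with h | h
      · have := boxSum_nonneg hF0 (fun a => A (p a))
        rw [← h] at hle ⊢
        linarith
      · exact div_mul_cancel₀ _ h.ne'
    have hD1 : D ≤ 1 := div_le_one_of_le₀ hle hN0
    have hD0 : 0 ≤ D := div_nonneg (boxSum_nonneg hF0 _) hN0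
    have hDM : D ≤ (M + 1 : ℕ) * γ := div_le_of_le_mul₀ hN0 (by positivity) hM
    by_cases hreg : ∀ B : κ → Finset V, (∀ a, B a ⊆ A (p a)) →
        -(γ * N) ≤ boxSum (fun v => F v - D) B
    · refine ⟨s, A, ?_, fun _ => subset_rfl, hA, D, fun B hB => abs_le.2 ⟨?_, ?_⟩⟩
      · exact mul_le_of_le_one_left (by positivity) (pow_le_one₀ hγ.le hγ1)
      · have h1 : (1 : ℝ) ≤ 2 ^ Fintype.card κ := one_le_pow₀ (by norm_num)
        have h2 : 0 ≤ γ * N := by positivity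
        nlinarith [hreg B hB]
      · refine boxSum_le_of_forall_subbox_ge _ _ _ (by positivity) ?_ hreg B hB
        rw [boxSum_sub_const, hprod, hDN, sub_self]
    · push Not at hreg
      obtain ⟨B, hBA, hB⟩ := hreg
      have hcard : ∀ a, (B a).card ≤ s := fun a => hA (p a) ▸ Finset.card_le_card (hBA a)
      have hBN : ∏ a, ((B a).card : ℝ) ≤ N := by
        rw [← hprod]
        exact Finset.prod_le_prod (fun _ _ => Nat.cast_nonneg _)
          fun a _ => Nat.cast_le.2 (Finset.card_le_card (hBA a))
      have hBP : 0 ≤ ∏ a, ((B a).card : ℝ) := Finset.prod_nonneg fun _ _ => Nat.cast_nonneg _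
      have hBlow : γ * N < ∏ a, ((B a).card : ℝ) := by
        have h0 := boxSum_nonneg hF0 B
        rw [boxSum_sub_const] at hB
        nlinarith
      -- A side shorter than `γ * s` would force the volume of `B` to be at most `γ * N`, against
      -- `hBlow`.
      have hBs : ∀ a, ⌈γ * s⌉₊ ≤ (B a).card := by
        intro a
        rw [Nat.ceil_le]
        by_contra! hlt
        rw [← Finset.mul_prod_erase _ _ (Finset.mem_univ a)] at hBlow
        have h1 : ∏ b ∈ Finset.univ.erase a, ((B b).card : ℝ) ≤
            ∏ b ∈ (Finset.univ : Finset κ).erase a, (s : ℝ) :=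
          Finset.prod_le_prod (fun _ _ => Nat.cast_nonneg _) fun b _ => by exact_mod_cast hcard b
        have h2 : N = s * ∏ b ∈ (Finset.univ : Finset κ).erase a, (s : ℝ) := by
          rw [Finset.mul_prod_erase _ (fun _ => (s : ℝ)) (Finset.mem_univ a)]
          simp [hN]
        have h3 : 0 ≤ ∏ b ∈ (Finset.univ : Finset κ).erase a, (s : ℝ) :=
          Finset.prod_nonneg fun _ _ => Nat.cast_nonneg _
        rw [h2, ← mul_assoc] at hBlow
        have h4 : ((B a).card : ℝ) * ∏ b ∈ Finset.univ.erase a, ((B b).card : ℝ) ≤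
            (γ * s) * ∏ b ∈ (Finset.univ : Finset κ).erase a, (s : ℝ) :=
          mul_le_mul hlt.le h1 (Finset.prod_nonneg fun _ _ => Nat.cast_nonneg _)
              (mul_nonneg hγ.le (Nat.cast_nonneg _))
        linarith
      have hs' : ⌈γ * s⌉₊ ≤ s := Nat.ceil_le.2 (mul_le_of_le_one_left (by positivity) hγ1)
      obtain ⟨C, hCB, hCs, hC⟩ := exists_subbox_card_eq_boxSum_nonpos
        (fun v => F v - (D - γ)) ⌈γ * s⌉₊ B hBs (by
          rw [boxSum_sub_const] at hB ⊢
          nlinarith)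
      -- Indices outside the range of `p` are shrunk arbitrarily, to keep one common size.
      have hX : ∀ i, ∃ X ⊆ A i, X.card = ⌈γ * s⌉₊ ∧ ∀ a, p a = i → X = C a := by
        intro i
        by_cases hi : ∃ a, p a = i
        · obtain ⟨a, rfl⟩ := hi
          exact ⟨C a, (hCB a).trans (hBA a), hCs a, fun b hb => by rw [p.injective hb]⟩
        · obtain ⟨X, hX, hXc⟩ := Finset.exists_subset_card_eq (hs'.trans (hA i).ge)
          exact ⟨X, hX, hXc, fun a ha => (hi ⟨a, ha⟩).elim⟩
      choose X hXA hXs hXC using hX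
      have hXp : (fun a => X (p a)) = C := funext fun a => hXC _ a rfl
      obtain ⟨s', A', h1, h2, h3, h4⟩ := ih ⌈γ * s⌉₊ X hXs (by
        rw [hXp]
        rw [boxSum_sub_const] at hC
        simp only [hCs, Finset.prod_const, Finset.card_univ] at hC
        push_cast at hDM
        have : (0 : ℝ) ≤ (⌈γ * s⌉₊ : ℝ) ^ Fintype.card κ := by positivity
        nlinarith)
      refine ⟨s', A', ?_, fun i => (h2 i).trans (hXA i), h3, h4⟩
      calc γ ^ (M + 1) * s = γ ^ M * (γ * s) := by ring
        _ ≤ γ ^ M * ⌈γ * s⌉₊ := by gcongr; exact Nat.le_ceil _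
        _ ≤ s' := h1

/-- Simultaneous regularisation: every family of sets of the same size has a subfamily, again of
sets of one common size, linear in the original one, on which all the given index tuples span
boxes on whose subboxes `F` is almost constant on average. -/
theorem exists_regular_subfamily (κ : Type*) [Fintype κ] [DecidableEq κ] {ι : Type*} (P : Finset (κ ↪ ι))
    {γ : ℝ} (hγ : 0 < γ) :
    ∃ c : ℝ, 0 < c ∧ ∀ {V : Type} (F : (κ → V) → ℝ), (∀ v, 0 ≤ F v) → (∀ v, F v ≤ 1) →
      ∀ (s : ℕ) (A : ι → Finset V), (∀ i, (A i).card = s) →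
      ∃ (s' : ℕ) (A' : ι → Finset V), c * s ≤ s' ∧ (∀ i, A' i ⊆ A i) ∧ (∀ i, (A' i).card = s') ∧
        ∀ p ∈ P, ∃ D : ℝ, ∀ B : κ → Finset V, (∀ a, B a ⊆ A' (p a)) →
          |boxSum (fun v => F v - D) B| ≤ γ * (s' : ℝ) ^ Fintype.card κ := by
  induction P using Finset.induction_on with
  | empty =>
    exact ⟨1, one_pos, fun F _ _ s A hA => ⟨s, A, by simp, fun _ => subset_rfl, hA, by simp⟩⟩
  | insert p P hp ih =>
    obtain ⟨c, hc, ih⟩ := ih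
    set k := Fintype.card κ
    -- The tuple `p` is treated first, then `P`. The factor `c ^ k` pays for the later shrinking, as
    -- errors are measured against the final size.
    set γ' : ℝ := min 1 (γ * c ^ k / 2 ^ k) with hγ'
    have hγ'0 : 0 < γ' := lt_min one_pos (by positivity)
    have hγ'1 : γ' ≤ 1 := min_le_left _ _
    have hγ'2 : 2 ^ k * γ' ≤ γ * c ^ k := by
      have := min_le_right 1 (γ * c ^ k / 2 ^ k)
      rw [← hγ', le_div_iff₀ (by positivity)] at this
      linarith
    obtain ⟨M, hM⟩ := exists_nat_ge (1 / γ')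
    rw [div_le_iff₀ hγ'0] at hM
    refine ⟨c * γ' ^ M, by positivity, fun F hF0 hF1 s A hA => ?_⟩
    obtain ⟨s₁, A₁, h1, h2, h3, D, h4⟩ := exists_regular_subfamily_of_boxSum_le hF0 hF1 p hγ'0 hγ'1
      M s A hA (by
        refine (boxSum_le_prod hF1 _).trans ?_
        simp only [hA, Finset.prod_const, Finset.card_univ]
        exact le_mul_of_one_le_left (by positivity) hM)
    obtain ⟨s₂, A₂, g1, g2, g3, g4⟩ := ih F hF0 hF1 s₁ A₁ h3
    refine ⟨s₂, A₂, ?_, fun i => (g2 i).trans (h2 i), g3, fun q hq => ?_⟩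
    · calc c * γ' ^ M * s = c * (γ' ^ M * s) := by ring
        _ ≤ c * s₁ := by gcongr
        _ ≤ s₂ := g1
    rcases Finset.mem_insert.1 hq with rfl | hq
    · refine ⟨D, fun B hB => (h4 B fun a => (hB a).trans (g2 _)).trans ?_⟩
      calc 2 ^ k * (γ' * (s₁ : ℝ) ^ k) = (2 ^ k * γ') * (s₁ : ℝ) ^ k := by ring
        _ ≤ (γ * c ^ k) * (s₁ : ℝ) ^ k := by gcongr
        _ = γ * (c * s₁) ^ k := by rw [mul_pow]; ring
        _ ≤ γ * (s₂ : ℝ) ^ k := by gcongr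
    · exact g4 q hq

end BoxSums

/-! ### Ramsey's theorem. -/

/-- Ramsey's theorem for two colours and uniform hypergraphs. -/
theorem exists_monochromatic_subset (r m n : ℕ) :
    ∃ N : ℕ, ∀ ⦃α : Type⦄ (X : Finset α), N ≤ X.card → ∀ c : Finset α → Prop,
      (∃ T ⊆ X, T.card = m ∧ ∀ s ⊆ T, s.card = r → c s) ∨
      (∃ T ⊆ X, T.card = n ∧ ∀ s ⊆ T, s.card = r → ¬ c s) := by
  classical
  induction r generalizing m n with
  | zero =>
    refine ⟨max m n, fun α X hX c => ?_⟩
    by_cases h : c ∅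
    · obtain ⟨T, hT, hTm⟩ := Finset.exists_subset_card_eq (le_trans (le_max_left m n) hX)
      exact .inl ⟨T, hT, hTm, fun s _ hs => by rwa [Finset.card_eq_zero.1 hs]⟩
    · obtain ⟨T, hT, hTm⟩ := Finset.exists_subset_card_eq (le_trans (le_max_right m n) hX)
      exact .inr ⟨T, hT, hTm, fun s _ hs => by rwa [Finset.card_eq_zero.1 hs]⟩
  | succ r ihr =>
    have hempty : ∀ {α : Type} (s : Finset α), s ⊆ ∅ → s.card = r + 1 → False := by
      intro α s hs h
      rw [Finset.subset_empty.1 hs] at h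
      simp at h
    have hinsert : ∀ {α : Type} (Q : Finset α → Prop) (x : α) (T T' : Finset α), T' ⊆ T →
        (∀ s ⊆ T, s.card = r → Q (insert x s)) → (∀ s ⊆ T', s.card = r + 1 → Q s) →
        ∀ s ⊆ insert x T', s.card = r + 1 → Q s := by
      intro α Q x T T' hT' h1 h2 s hs hsr
      by_cases hx : x ∈ s
      · have := h1 (s.erase x) ((Finset.subset_insert_iff.1 hs).trans hT')
          (by rw [Finset.card_erase_of_mem hx, hsr]; rfl)
        rwa [Finset.insert_erase hx] at this
      · exact h2 s ((Finset.subset_insert_iff_of_notMem hx).1 hs) hsr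
    induction m generalizing n with
    | zero => exact ⟨0, fun α X _ c => .inl ⟨∅, by simp, rfl, fun s hs h => (hempty s hs h).elim⟩⟩
    | succ m ihm =>
      induction n with
      | zero => exact ⟨0, fun α X _ c => .inr ⟨∅, by simp, rfl, fun s hs h => (hempty s hs h).elim⟩⟩
      | succ n ihn =>
        obtain ⟨N₁, h₁⟩ := ihm (n + 1)
        obtain ⟨N₂, h₂⟩ := ihn
        obtain ⟨N, hN⟩ := ihr N₁ N₂
        refine ⟨N + 1, fun α X hX c => ?_⟩
        obtain ⟨x, hx⟩ := Finset.card_pos.1 (by omega : 0 < X.card)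
        have hX' : ∀ T ⊆ X.erase x, T ⊆ X ∧ insert x T ⊆ X ∧ (insert x T).card = T.card + 1 := by
          intro T hT
          have := hT.trans (Finset.erase_subset x X)
          exact ⟨this, Finset.insert_subset hx this,
            Finset.card_insert_of_notMem fun h => Finset.notMem_erase x X (hT h)⟩
        -- Colouring `r`-sets by their union with `x` yields a set `T` on which all edges through
        -- `x` have one colour; a homogeneous set inside `T` may then be extended by `x` in that
        -- colour.
        obtain ⟨T, hT, hTc, hTr⟩ | ⟨T, hT, hTc, hTr⟩ := hN (X.erase x)
          (by rw [Finset.card_erase_of_mem hx]; omega) (fun s => c (insert x s))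
        · obtain ⟨T', hT', hc, hr⟩ | ⟨T', hT', hc, hr⟩ := h₁ T hTc.ge c
          · obtain ⟨-, k2, k3⟩ := hX' T' (hT'.trans hT)
            exact .inl ⟨insert x T', k2, by rw [k3, hc], hinsert c x T T' hT' hTr hr⟩
          · exact .inr ⟨T', (hX' T' (hT'.trans hT)).1, hc, hr⟩
        · obtain ⟨T', hT', hc, hr⟩ | ⟨T', hT', hc, hr⟩ := h₂ T hTc.ge c
          · exact .inl ⟨T', (hX' T' (hT'.trans hT)).1, hc, hr⟩
          · obtain ⟨-, k2, k3⟩ := hX' T' (hT'.trans hT)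
            exact .inr ⟨insert x T', k2, by rw [k3, hc],
              hinsert (fun s => ¬ c s) x T T' hT' hTr hr⟩

/-! ### Counting tuples, injections and colourings. -/

section TupleCounting

open Classical

theorem card_filter_image_mem {V : Type*} [Fintype V] (k : ℕ) (C : Finset (Finset V))
    (hC : ∀ s ∈ C, s.card = k) :
    ({v : Fin k → V | Finset.univ.image v ∈ C} : Finset (Fin k → V)).card =
      k.factorial * C.card := by
  rw [Finset.card_eq_sum_card_fiberwise (f := fun v : Fin k → V => Finset.univ.image v) (t := C)
    (fun v hv => by simpa using hv), mul_comm]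
  refine Finset.sum_const_nat fun s hs => ?_
  have hcard : Fintype.card (Fin k) = Fintype.card s := by simp [hC s hs]
  have h1 : (Finset.univ : Finset (Fin k ≃ s)).card = k.factorial := by
    rw [Finset.card_univ, Fintype.card_equiv (Fintype.equivOfCardEq hcard), Fintype.card_fin]
  rw [← h1]
  symm
  refine Finset.card_bij (fun e _ a => (e a : V)) (fun e _ => ?_) (fun e _ e' _ h => ?_)
    fun v hv => ?_
  · have : Finset.univ.image (fun a => (e a : V)) = s := by
      ext x
      simp only [Finset.mem_image, Finset.mem_univ, true_and]
      exact ⟨fun ⟨a, ha⟩ => ha ▸ (e a).2, fun hx => ⟨e.symm ⟨x, hx⟩, by simp⟩⟩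
    simp [this, hs]
  · ext a
    exact congrFun h a
  · have hv' : Finset.univ.image v = s := by simpa using (Finset.mem_filter.1 hv).2
    have hmem : ∀ a, v a ∈ s := fun a => hv' ▸ Finset.mem_image_of_mem v (Finset.mem_univ a)
    have hsurj : Function.Surjective (fun a => (⟨v a, hmem a⟩ : s)) := by
      rintro ⟨x, hx⟩
      have hx' := hx
      rw [← hv'] at hx'
      obtain ⟨a, -, ha⟩ := Finset.mem_image.1 hx'
      exact ⟨a, Subtype.ext ha⟩
    exact ⟨Equiv.ofBijective _
      ((Fintype.bijective_iff_surjective_and_card _).2 ⟨hsurj, hcard⟩), Finset.mem_univ _, rfl⟩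

/-- At most `k ^ 2 * n ^ (k - 1)` tuples repeat an entry; the factor `n` avoids the exponent `k -
1`. -/
theorem mul_pow_sub_descFactorial_le (k n : ℕ) :
    (n : ℝ) * ((n : ℝ) ^ k - n.descFactorial k) ≤ (k : ℝ) ^ 2 * (n : ℝ) ^ k := by
  induction k with
  | zero => simp
  | succ k ih =>
    rw [Nat.descFactorial_succ]
    push_cast
    have h1 : (n : ℝ) - k ≤ ((n - k : ℕ) : ℝ) := by
      rw [sub_le_iff_le_add]
      exact_mod_cast (by omega : n ≤ n - k + k)
    have h2 : (n.descFactorial k : ℝ) ≤ (n : ℝ) ^ k := by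
      exact_mod_cast Nat.descFactorial_le_pow n k
    have h3 : (0 : ℝ) ≤ n.descFactorial k := by positivity
    have hn : (0 : ℝ) ≤ n := by positivity
    have hk : (0 : ℝ) ≤ k := by positivity
    have h4 : ((n : ℝ) - k) * n.descFactorial k ≤ ((n - k : ℕ) : ℝ) * n.descFactorial k := by
      gcongr
    have h5 : (n : ℝ) ^ (k + 1) - ((n - k : ℕ) : ℝ) * n.descFactorial k ≤
        n * ((n : ℝ) ^ k - n.descFactorial k) + k * (n : ℝ) ^ k := by
      have : (k : ℝ) * n.descFactorial k ≤ k * (n : ℝ) ^ k := by gcongr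
      rw [pow_succ]
      nlinarith
    calc (n : ℝ) * ((n : ℝ) ^ (k + 1) - ((n - k : ℕ) : ℝ) * n.descFactorial k)
        ≤ n * ((k : ℝ) ^ 2 * (n : ℝ) ^ k + k * (n : ℝ) ^ k) := by gcongr; linarith
      _ = ((k : ℝ) ^ 2 + k) * (n : ℝ) ^ (k + 1) := by ring
      _ ≤ ((k : ℝ) + 1) ^ 2 * (n : ℝ) ^ (k + 1) := by gcongr; nlinarith

theorem pow_sub_descFactorial_le {k n : ℕ} {θ : ℝ} (hn : 0 < n) (hθ : (k : ℝ) ^ 2 ≤ θ * n) :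
    (n : ℝ) ^ k - n.descFactorial k ≤ θ * (n : ℝ) ^ k := by
  have hn' : (0 : ℝ) < n := by exact_mod_cast hn
  refine le_of_mul_le_mul_left ?_ hn'
  calc (n : ℝ) * ((n : ℝ) ^ k - n.descFactorial k) ≤ (k : ℝ) ^ 2 * (n : ℝ) ^ k :=
        mul_pow_sub_descFactorial_le k n
    _ ≤ θ * n * (n : ℝ) ^ k := by gcongr
    _ = n * (θ * (n : ℝ) ^ k) := by ring

theorem card_filter_not_injective_le {X : Type*} [Fintype X] {k : ℕ} {θ : ℝ}
    (hX : 0 < Fintype.card X) (hθ : (k : ℝ) ^ 2 ≤ θ * Fintype.card X) :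
    (({v : Fin k → X | ¬ Function.Injective v} : Finset (Fin k → X)).card : ℝ) ≤
      θ * (Fintype.card X : ℝ) ^ k := by
  have h := Finset.card_filter_add_card_filter_not (s := (Finset.univ : Finset (Fin k → X)))
    Function.Injective
  have h1 : ({v : Fin k → X | Function.Injective v} : Finset (Fin k → X)).card =
      (Fintype.card X).descFactorial k := by
    rw [← Fintype.card_subtype, Fintype.card_congr (Equiv.subtypeInjectiveEquivEmbedding _ _),
      Fintype.card_embedding_eq, Fintype.card_fin]
  rw [h1, Finset.card_univ, Fintype.card_fun, Fintype.card_fin] at h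
  have h2 : ((Fintype.card X).descFactorial k : ℝ) +
      ({v : Fin k → X | ¬ Function.Injective v} : Finset (Fin k → X)).card =
      (Fintype.card X : ℝ) ^ k := by exact_mod_cast h
  linarith [pow_sub_descFactorial_le hX hθ]

/-- The colours of `k` distinct vertices are prescribed and the others are free, so a uniform
colouring fits `v` with probability `k ^ (-k)`. -/
theorem card_filter_forall_apply_eq {V : Type*} [Fintype V] {k : ℕ} {v : Fin k → V}
    (hv : Function.Injective v) :
    k ^ k * ({c : V → Fin k | ∀ i, c (v i) = i} : Finset (V → Fin k)).card =
      k ^ Fintype.card V := by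
  have h : ({c : V → Fin k | ∀ i, c (v i) = i} : Finset (V → Fin k)) =
      Fintype.piFinset fun x => ({a | ∀ i, v i = x → a = i} : Finset (Fin k)) := by
    ext c
    simp only [Finset.mem_filter, Finset.mem_univ, true_and, Fintype.mem_piFinset]
    exact ⟨fun h x i hi => hi ▸ h i, fun h i => h _ i rfl⟩
  have ht : ∀ x, ({a | ∀ i, v i = x → a = i} : Finset (Fin k)).card =
      if x ∈ Finset.univ.image v then 1 else k := by
    intro x
    split_ifs with hx
    · obtain ⟨i, -, rfl⟩ := Finset.mem_image.1 hx
      rw [Finset.card_eq_one]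
      exact ⟨i, by ext a; simp [hv.eq_iff]⟩
    · have : ({a | ∀ i, v i = x → a = i} : Finset (Fin k)) = Finset.univ := by
        refine Finset.filter_true_of_mem fun a _ i hi => (hx ?_).elim
        exact hi ▸ Finset.mem_image_of_mem v (Finset.mem_univ i)
      rw [this, Finset.card_univ, Fintype.card_fin]
  have hk : (Finset.univ.image v).card = k := by
    rw [Finset.card_image_of_injective _ hv, Finset.card_univ, Fintype.card_fin]
  rw [h, Fintype.card_piFinset, Finset.prod_congr rfl fun x _ => ht x, Finset.prod_ite,
    Finset.prod_const_one, one_mul, Finset.prod_const, ← pow_add]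
  congr 1
  have := Finset.card_filter_add_card_filter_not (s := (Finset.univ : Finset V))
    (· ∈ Finset.univ.image v)
  rw [Finset.filter_univ_mem, hk] at this
  rw [← Finset.card_univ, ← this]

theorem injective_of_card_image_eq {V : Type*} {k : ℕ} {v : Fin k → V}
    (h : (Finset.univ.image v).card = k) : Function.Injective v := by
  have := Finset.card_image_iff.1 (h.trans (by simp) : _ = (Finset.univ : Finset (Fin k)).card)
  simpa using this

theorem image_univ_restrict {α V : Type*} (v : α → V) (S : Finset α) :
    Finset.univ.image (fun i : S => v i) = S.image v := by
  ext x
  simp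

end TupleCounting

/-! ### Comparing the two notions of density; random colourings for `j ≥ 2`. -/

namespace UniformHypergraph

open Classical in
theorem IsFamilyDense.isDense {V : Type*} [Fintype V] {k j : ℕ} {H : UniformHypergraph k V}
    {d η : ℝ} (hd : 0 ≤ d) (hη : 0 ≤ η)
    (h : H.IsFamilyDense d η (Finset.powersetCard j Finset.univ)) : H.IsDense d η j := by
  intro G
  have h := h fun S => {f | Finset.univ.image f ∈ G.edges}
  have hC : ∀ s ∈ G.cliques k, s.card = k := fun s hs =>
    (Finset.mem_powersetCard.1 (Finset.mem_filter.1 hs).1).2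
  have h1 := card_filter_image_mem k (G.cliques k) hC
  have h2 := card_filter_image_mem k (G.cliques k ∩ H.edges)
    fun s hs => hC s (Finset.mem_inter.1 hs).1
  -- Inclusion suffices because `0 ≤ d`; for `j = 1` the right side also contains non-injective
  -- tuples.
  have h3 : ({v : Fin k → V | Finset.univ.image v ∈ G.cliques k} : Finset (Fin k → V)) ⊆
      tupleCliques fun S : (Finset.powersetCard j (Finset.univ : Finset (Fin k))) =>
        {f | Finset.univ.image f ∈ G.edges} := by
    intro v hv
    rw [Finset.mem_filter] at hv
    have hinj := injective_of_card_image_eq (hC _ hv.2)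
    simp only [tupleCliques, Finset.mem_filter, Finset.mem_univ, true_and, Set.mem_ofPred_eq]
    intro S
    rw [image_univ_restrict]
    refine (Finset.mem_filter.1 hv.2).2 (Finset.mem_powersetCard.2
      ⟨Finset.image_subset_image (Finset.subset_univ _), ?_⟩)
    rw [Finset.card_image_of_injective _ hinj, (Finset.mem_powersetCard.1 S.2).2]
  have h4 : (H.tupleEdges fun S : (Finset.powersetCard j (Finset.univ : Finset (Fin k))) =>
        {f | Finset.univ.image f ∈ G.edges}) ⊆
      ({v : Fin k → V | Finset.univ.image v ∈ G.cliques k ∩ H.edges} : Finset (Fin k → V)) := by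
    intro v hv
    simp only [tupleEdges, tupleCliques, Finset.mem_filter, Finset.mem_univ, true_and,
      Set.mem_ofPred_eq] at hv
    obtain ⟨hv, hvE⟩ := hv
    have hk := H.card_of_mem _ hvE
    have hinj := injective_of_card_image_eq hk
    simp only [Finset.mem_filter, Finset.mem_univ, true_and, Finset.mem_inter, hvE, and_true,
      cliques, Finset.mem_powersetCard, Finset.subset_univ, hk]
    intro e he
    obtain ⟨he, hej⟩ := Finset.mem_powersetCard.1 he
    obtain ⟨S, -, rfl⟩ := Finset.subset_image_iff.1 he
    rw [Finset.card_image_of_injective _ hinj] at hej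
    rw [← image_univ_restrict]
    exact hv ⟨S, Finset.mem_powersetCard.2 ⟨Finset.subset_univ _, hej⟩⟩
  have h3 := Finset.card_le_card h3
  have h4 := Finset.card_le_card h4
  rw [h1] at h3
  rw [h2] at h4
  have h3 := Nat.cast_le (α := ℝ).2 h3
  have h4 := Nat.cast_le (α := ℝ).2 h4
  push_cast at h3 h4
  have hf : (1 : ℝ) ≤ k.factorial := by exact_mod_cast Nat.succ_le_of_lt k.factorial_pos
  have hη' : η * (Fintype.card V : ℝ) ^ k ≤ k.factorial * (η * (Fintype.card V : ℝ) ^ k) :=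
    le_mul_of_one_le_left (by positivity) hf
  refine le_of_mul_le_mul_left ?_ (zero_lt_one.trans_le hf)
  have h3 := mul_le_mul_of_nonneg_left h3 hd
  linarith

open Classical in
/-- The `j`-sets that receive pairwise different colours `c` and that, listed by colour, belong to
the family `G`. -/
noncomputable def rainbowGraph {V : Type*} [Fintype V] {k j : ℕ} (c : V → Fin k)
    (G : (S : Finset.powersetCard j (Finset.univ : Finset (Fin k))) → Set (S.1 → V)) :
    UniformHypergraph j V where
  edges := {e | ∃ S, ∃ f ∈ G S, (∀ i, c (f i) = i) ∧ Finset.univ.image f = e}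
  card_of_mem := by
    intro e he
    obtain ⟨S, f, -, hc, rfl⟩ := (Finset.mem_filter.1 he).2
    have hf : Function.Injective f := fun a b hab => Subtype.ext (by rw [← hc a, ← hc b, hab])
    rw [Finset.card_image_of_injective _ hf, Finset.card_univ, Fintype.card_coe,
      (Finset.mem_powersetCard.1 S.2).2]

section Rainbow

open Classical

variable {V : Type*} [Fintype V] {k j : ℕ} {c : V → Fin k}
  {G : (S : Finset.powersetCard j (Finset.univ : Finset (Fin k))) → Set (S.1 → V)}

theorem mem_rainbowGraph_edges {e : Finset V} : e ∈ (rainbowGraph c G).edges ↔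
    ∃ S, ∃ f ∈ G S, (∀ i, c (f i) = i) ∧ Finset.univ.image f = e := by
  simp [rainbowGraph]

/-- Colours recover both the index set `S` and the labelling of an edge, so distinct members of the
family do not interfere. -/
theorem image_mem_cliques_rainbowGraph_iff {v : Fin k → V} (hv : ∀ i, c (v i) = i) :
    Finset.univ.image v ∈ (rainbowGraph c G).cliques k ↔ v ∈ tupleCliques G := by
  have hinj : Function.Injective v := fun a b hab => by rw [← hv a, ← hv b, hab]
  have hk : (Finset.univ.image v).card = k := by
    rw [Finset.card_image_of_injective _ hinj, Finset.card_univ, Fintype.card_fin]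
  simp only [cliques, Finset.mem_filter, Finset.mem_powersetCard, Finset.subset_univ, hk,
    true_and, tupleCliques, Finset.mem_univ]
  constructor
  · rintro h ⟨S, hS⟩
    have hmem : S.image v ∈ (rainbowGraph c G).edges := by
      refine h (Finset.mem_powersetCard.2 ⟨Finset.image_subset_image (Finset.subset_univ _), ?_⟩)
      rw [Finset.card_image_of_injective _ hinj, (Finset.mem_powersetCard.1 hS).2]
    obtain ⟨⟨S', hS'⟩, f, hf, hc, he⟩ := mem_rainbowGraph_edges.1 hmem
    have hfv : ∀ i : S', (i : Fin k) ∈ S ∧ f i = v i := by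
      intro i
      have : f i ∈ S.image v := he ▸ Finset.mem_image_of_mem f (Finset.mem_univ i)
      obtain ⟨a, ha, hav⟩ := Finset.mem_image.1 this
      have : a = i := by rw [← hv a, hav, hc]
      exact ⟨this ▸ ha, by rw [← hav, this]⟩
    have hSS : S' = S := Finset.eq_of_subset_of_card_le (fun i hi => (hfv ⟨i, hi⟩).1)
      (by rw [(Finset.mem_powersetCard.1 hS).2, (Finset.mem_powersetCard.1 hS').2])
    subst hSS
    rwa [show f = fun i : S' => v i from funext fun i => (hfv i).2] at hf
  · intro h e he
    obtain ⟨he, hej⟩ := Finset.mem_powersetCard.1 he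
    obtain ⟨S, -, rfl⟩ := Finset.subset_image_iff.1 he
    rw [Finset.card_image_of_injective _ hinj] at hej
    refine mem_rainbowGraph_edges.2 ⟨⟨S, Finset.mem_powersetCard.2 ⟨Finset.subset_univ _, hej⟩⟩,
      fun i => v i, h _, fun i => hv i, ?_⟩
    exact image_univ_restrict v S

/-- Any two vertices of a clique lie in a common `j`-subset because `j ≥ 2`, and that subset is
rainbow. This is the step that fails for `j = 1`. -/
theorem exists_image_eq_of_mem_cliques_rainbowGraph (hj : 2 ≤ j) (hjk : j ≤ k) {s : Finset V}
    (hs : s ∈ (rainbowGraph c G).cliques k) :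
    ∃ v : Fin k → V, (∀ i, c (v i) = i) ∧ Finset.univ.image v = s := by
  obtain ⟨hsk, hsj⟩ := Finset.mem_filter.1 hs
  have hsk := (Finset.mem_powersetCard.1 hsk).2
  have hc : Set.InjOn c s := by
    intro x hx y hy hxy
    obtain ⟨e, hxe, hes, hej⟩ := Finset.exists_subsuperset_card_eq (s := {x, y}) (t := s) (n := j)
      (Finset.insert_subset hx (Finset.singleton_subset_iff.2 hy))
      (Finset.card_le_two.trans hj) (hsk.symm ▸ hjk)
    obtain ⟨S, f, -, hcf, rfl⟩ := mem_rainbowGraph_edges.1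
      (hsj (Finset.mem_powersetCard.2 ⟨hes, hej⟩))
    obtain ⟨a, -, rfl⟩ := Finset.mem_image.1 (hxe (Finset.mem_insert_self _ _))
    obtain ⟨b, -, rfl⟩ := Finset.mem_image.1
      (hxe (Finset.mem_insert_of_mem (Finset.mem_singleton_self _)))
    rw [hcf, hcf] at hxy
    rw [Subtype.ext hxy]
  have himg : s.image c = Finset.univ := by
    apply Finset.eq_univ_of_card
    rw [Finset.card_image_of_injOn hc, hsk, Fintype.card_fin]
  have hex : ∀ i, ∃ x ∈ s, c x = i := fun i => by
    simpa using himg.ge (Finset.mem_univ i)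
  choose v hvs hvc using hex
  have hinj : Function.Injective v := fun a b hab => by rw [← hvc a, ← hvc b, hab]
  refine ⟨v, hvc, Finset.eq_of_subset_of_card_le (Finset.image_subset_iff.2 fun i _ => hvs i) ?_⟩
  rw [Finset.card_image_of_injective _ hinj, Finset.card_univ, Fintype.card_fin, hsk]

end Rainbow

-- The density of `H` is applied to the rainbow graph of every colouring and averaged. The factor `k
-- ^ k` is the inverse probability that an injective tuple is correctly coloured; `θ` absorbs the
-- non-injective tuples.
open Classical in
theorem IsDense.isFamilyDense {V : Type*} [Fintype V] {k j : ℕ} (hj : 2 ≤ j) (hjk : j ≤ k)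
    {H : UniformHypergraph k V} {d η θ : ℝ} (hd0 : 0 ≤ d) (hd1 : d ≤ 1)
    (hV : 0 < Fintype.card V) (hθ : (k : ℝ) ^ 2 ≤ θ * Fintype.card V) (h : H.IsDense d η j) :
    H.IsFamilyDense d (k ^ k * η + θ) (Finset.powersetCard j Finset.univ) := by
  intro G
  set n := Fintype.card V
  have hc : ∀ c : V → Fin k,
      d * (({v ∈ tupleCliques G | ∀ i, c (v i) = i} : Finset _).card : ℝ) - η * (n : ℝ) ^ k ≤
        (({v ∈ H.tupleEdges G | ∀ i, c (v i) = i} : Finset _).card : ℝ) := by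
    intro c
    have h1 : ({v ∈ tupleCliques G | ∀ i, c (v i) = i} : Finset _).card ≤
        ((rainbowGraph c G).cliques k).card := by
      refine Finset.card_le_card_of_injOn (fun v => Finset.univ.image v) (fun v hv => ?_)
        fun v hv w hw hvw => ?_
      · obtain ⟨hv, hvc⟩ := Finset.mem_filter.1 hv
        exact (image_mem_cliques_rainbowGraph_iff hvc).2 hv
      · have hvc := (Finset.mem_filter.1 hv).2
        have hwc := (Finset.mem_filter.1 hw).2
        funext i
        have : v i ∈ Finset.univ.image w :=
          (show Finset.univ.image v = Finset.univ.image w from hvw) ▸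
            Finset.mem_image_of_mem v (Finset.mem_univ i)
        obtain ⟨a, -, ha⟩ := Finset.mem_image.1 this
        have hai : a = i := by rw [← hwc a, ha, hvc]
        rw [← ha, hai]
    have h2 : ((rainbowGraph c G).cliques k ∩ H.edges).card ≤
        ({v ∈ H.tupleEdges G | ∀ i, c (v i) = i} : Finset _).card := by
      refine (Finset.card_le_card fun s hs => ?_).trans
        (Finset.card_image_le (f := fun v : Fin k → V => Finset.univ.image v))
      obtain ⟨hs, hsE⟩ := Finset.mem_inter.1 hs
      obtain ⟨v, hvc, rfl⟩ := exists_image_eq_of_mem_cliques_rainbowGraph hj hjk hs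
      exact Finset.mem_image.2 ⟨v, Finset.mem_filter.2 ⟨Finset.mem_filter.2
        ⟨(image_mem_cliques_rainbowGraph_iff hvc).1 hs, hsE⟩, hvc⟩, rfl⟩
    have h1 : (({v ∈ tupleCliques G | ∀ i, c (v i) = i} : Finset _).card : ℝ) ≤
        ((rainbowGraph c G).cliques k).card := by exact_mod_cast h1
    have h2 : (((rainbowGraph c G).cliques k ∩ H.edges).card : ℝ) ≤
        (({v ∈ H.tupleEdges G | ∀ i, c (v i) = i} : Finset _).card : ℝ) := by exact_mod_cast h2
    have := h (rainbowGraph c G)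
    have := mul_le_mul_of_nonneg_left h1 hd0
    linarith
  have hcount : ∀ T : Finset (Fin k → V),
      k ^ k * ∑ c : V → Fin k, ({v ∈ T | ∀ i, c (v i) = i} : Finset _).card =
        k ^ n * ({v ∈ T | Function.Injective v} : Finset _).card := by
    intro T
    have e := Finset.sum_card_bipartiteAbove_eq_sum_card_bipartiteBelow (s := T)
      (t := (Finset.univ : Finset (V → Fin k))) (fun v c => ∀ i, c (v i) = i)
    simp only [Finset.bipartiteAbove, Finset.bipartiteBelow] at e
    rw [← e, Finset.mul_sum, Finset.card_filter, Finset.mul_sum]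
    refine Finset.sum_congr rfl fun v _ => ?_
    split_ifs with hv
    · rw [card_filter_forall_apply_eq hv, mul_one]
    · rw [Finset.filter_false_of_mem fun c _ hc => hv fun a b hab => by rw [← hc a, ← hc b, hab]]
      simp
  have hsum := Finset.sum_le_sum fun c (_ : c ∈ (Finset.univ : Finset (V → Fin k))) => hc c
  rw [Finset.sum_sub_distrib, ← Finset.mul_sum, Finset.sum_const, Finset.card_univ,
    Fintype.card_fun, Fintype.card_fin, nsmul_eq_mul] at hsum
  have hC : (k : ℝ) ^ k * ∑ c : V → Fin k,
      (({v ∈ tupleCliques G | ∀ i, c (v i) = i} : Finset _).card : ℝ) =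
        (k : ℝ) ^ n * ({v ∈ tupleCliques G | Function.Injective v} : Finset _).card := by
    exact_mod_cast hcount (tupleCliques G)
  have hE : (k : ℝ) ^ k * ∑ c : V → Fin k,
      (({v ∈ H.tupleEdges G | ∀ i, c (v i) = i} : Finset _).card : ℝ) =
        (k : ℝ) ^ n * ({v ∈ H.tupleEdges G | Function.Injective v} : Finset _).card := by
    exact_mod_cast hcount (H.tupleEdges G)
  have hEle : (({v ∈ H.tupleEdges G | Function.Injective v} : Finset _).card : ℝ) ≤
      (H.tupleEdges G).card := by exact_mod_cast Finset.card_filter_le _ _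
  have hCle : ((tupleCliques G).card : ℝ) ≤
      ({v ∈ tupleCliques G | Function.Injective v} : Finset _).card + θ * (n : ℝ) ^ k := by
    have h1 := Finset.card_filter_add_card_filter_not (s := tupleCliques G) Function.Injective
    have h2 : ({v ∈ tupleCliques G | ¬ Function.Injective v} : Finset _).card ≤
        ({v : Fin k → V | ¬ Function.Injective v} : Finset (Fin k → V)).card :=
      Finset.card_le_card (Finset.filter_subset_filter _ (Finset.subset_univ _))
    have h3 := card_filter_not_injective_le hV hθ
    have h1 : (({v ∈ tupleCliques G | Function.Injective v} : Finset _).card : ℝ) +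
      ({v ∈ tupleCliques G | ¬ Function.Injective v} : Finset _).card =
        (tupleCliques G).card := by exact_mod_cast h1
    have h2 : (({v ∈ tupleCliques G | ¬ Function.Injective v} : Finset _).card : ℝ) ≤
        ({v : Fin k → V | ¬ Function.Injective v} : Finset (Fin k → V)).card := by
      exact_mod_cast h2
    linarith
  have hk : (0 : ℝ) < (k : ℝ) ^ k := by
    have : 0 < k := by omega
    positivity
  have hkn : (0 : ℝ) < (k : ℝ) ^ n := by
    have : 0 < k := by omega
    positivity
  have hmain : d * ({v ∈ tupleCliques G | Function.Injective v} : Finset _).card -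
      k ^ k * η * (n : ℝ) ^ k ≤ ({v ∈ H.tupleEdges G | Function.Injective v} : Finset _).card := by
    refine le_of_mul_le_mul_left ?_ hkn
    have := mul_le_mul_of_nonneg_left hsum hk.le
    rw [hE] at this
    calc _ = d * ((k : ℝ) ^ n * ({v ∈ tupleCliques G | Function.Injective v} : Finset _).card) -
          (k : ℝ) ^ n * (k ^ k * η * (n : ℝ) ^ k) := by ring
      _ ≤ _ := by
        rw [← hC]
        refine le_of_eq_of_le ?_ this
        push_cast
        ring
  have hθ0 : 0 ≤ θ * (n : ℝ) ^ k := by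
    have hn : (0 : ℝ) < n := by exact_mod_cast hV
    have : 0 ≤ θ := by
      by_contra! hneg
      nlinarith [sq_nonneg (k : ℝ)]
    positivity
  have := mul_le_mul_of_nonneg_left hCle hd0
  have := mul_le_mul_of_nonneg_right hd1 hθ0
  linarith

end UniformHypergraph

/-! ### Passing between a union of parts and boxes over the parts. -/

section Partition

open Classical

variable {κ ι V : Type*} [Fintype κ] [DecidableEq κ] [Fintype ι]

theorem boxSum_eq_sum_inter [Nonempty ι] (F : (κ → V) → ℝ) {A : ι → Finset V}
    (hA : ∀ i j x, x ∈ A i → x ∈ A j → i = j) {B : κ → Finset V}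
    (hB : ∀ a, B a ⊆ Finset.univ.biUnion A) :
    boxSum F B = ∑ p : κ → ι, boxSum F (fun a => B a ∩ A (p a)) := by
  have hq : ∀ x, ∃ i, ∀ j, x ∈ A j → j = i := by
    intro x
    by_cases h : ∃ i, x ∈ A i
    · obtain ⟨i, hi⟩ := h
      exact ⟨i, fun j hj => hA j i x hj hi⟩
    -- Points outside all parts get a dummy index; they do not occur in `B`.
    · exact ⟨Classical.arbitrary ι, fun j hj => (h ⟨j, hj⟩).elim⟩
  choose q hq using hq
  rw [boxSum_eq_sum_fiber F B fun _ => q]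
  refine Finset.sum_congr rfl fun p _ => ?_
  congr 1
  funext a
  ext x
  simp only [Finset.mem_filter, Finset.mem_inter]
  refine and_congr_right fun hx => ⟨fun h => ?_, fun h => (hq x _ h).symm⟩
  obtain ⟨i, -, hi⟩ := Finset.mem_biUnion.1 (hB a hx)
  rwa [← h, ← hq x i hi]

/-- Cut the box along the parts. Injective index tuples lose `δ` each; the others are at most a `θ`
fraction and lose at most their full volume. -/
theorem le_boxSum_of_injective {k : ℕ} [Nonempty ι] {F : (Fin k → V) → ℝ} (hF0 : ∀ v, 0 ≤ F v)
    {A : ι → Finset V} (hA : ∀ i j x, x ∈ A i → x ∈ A j → i = j) {s : ℕ}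
    (hs : ∀ i, (A i).card = s) {d δ θ : ℝ} (hd1 : d ≤ 1) (hδ : 0 ≤ δ)
    (hθ : (k : ℝ) ^ 2 ≤ θ * Fintype.card ι)
    (h : ∀ p : Fin k → ι, Function.Injective p → ∀ B : Fin k → Finset V, (∀ a, B a ⊆ A (p a)) →
      d * ∏ a, ((B a).card : ℝ) - δ * (s : ℝ) ^ k ≤ boxSum F B)
    {B : Fin k → Finset V} (hB : ∀ a, B a ⊆ Finset.univ.biUnion A) :
    d * ∏ a, ((B a).card : ℝ) - (δ + θ) * ((Fintype.card ι : ℝ) * s) ^ k ≤ boxSum F B := by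
  have e := boxSum_eq_sum_inter (fun v => F v - d) hA hB
  rw [boxSum_sub_const] at e
  have hle : ∑ p : Fin k → ι,
      (-(δ * (s : ℝ) ^ k) + if ¬ Function.Injective p then -((s : ℝ) ^ k) else 0) ≤
      ∑ p : Fin k → ι, boxSum (fun v => F v - d) (fun a => B a ∩ A (p a)) := by
    refine Finset.sum_le_sum fun p _ => ?_
    rw [boxSum_sub_const]
    by_cases hp : Function.Injective p
    · have := h p hp (fun a => B a ∩ A (p a)) fun a => Finset.inter_subset_right
      simp only [hp, not_true_eq_false, if_false]
      linarith
    · simp only [hp, not_false_eq_true, if_true]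
      have h0 := boxSum_nonneg hF0 fun a => B a ∩ A (p a)
      have h1 : ∏ a, ((B a ∩ A (p a)).card : ℝ) ≤ ∏ _a : Fin k, (s : ℝ) :=
        Finset.prod_le_prod (fun _ _ => Nat.cast_nonneg _) fun a _ =>
          Nat.cast_le.2 (hs (p a) ▸ Finset.card_le_card Finset.inter_subset_right)
      rw [Finset.prod_const, Finset.card_univ, Fintype.card_fin] at h1
      have h2 : 0 ≤ ∏ a, ((B a ∩ A (p a)).card : ℝ) :=
        Finset.prod_nonneg fun _ _ => Nat.cast_nonneg _
      have h3 : 0 ≤ δ * (s : ℝ) ^ k := by positivity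
      nlinarith
  rw [Finset.sum_add_distrib, ← Finset.sum_filter, Finset.sum_const, Finset.sum_const,
    Finset.card_univ, Fintype.card_fun, Fintype.card_fin, nsmul_eq_mul, nsmul_eq_mul] at hle
  have hni := card_filter_not_injective_le Fintype.card_pos hθ
  have := mul_le_mul_of_nonneg_right hni (by positivity : (0 : ℝ) ≤ (s : ℝ) ^ k)
  push_cast at hle
  rw [mul_pow]
  linarith

theorem boxSum_biUnion_le {k : ℕ} [Nonempty ι] {F : (Fin k → V) → ℝ} (hF1 : ∀ v, F v ≤ 1)
    {A : ι → Finset V} (hA : ∀ i j x, x ∈ A i → x ∈ A j → i = j) {s : ℕ}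
    (hs : ∀ i, (A i).card = s) {d θ : ℝ} (hd : 0 ≤ d) (hθ : (k : ℝ) ^ 2 ≤ θ * Fintype.card ι)
    (h : ∀ p : Fin k → ι, Function.Injective p → boxSum F (fun a => A (p a)) ≤ d * (s : ℝ) ^ k) :
    boxSum F (fun _ => Finset.univ.biUnion A) ≤ (d + θ) * ((Fintype.card ι : ℝ) * s) ^ k := by
  rw [boxSum_eq_sum_inter F hA fun _ => subset_rfl]
  have hle : ∑ p : Fin k → ι, boxSum F (fun a => Finset.univ.biUnion A ∩ A (p a)) ≤
      ∑ p : Fin k → ι, (d * (s : ℝ) ^ k + if ¬ Function.Injective p then (s : ℝ) ^ k else 0) := by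
    refine Finset.sum_le_sum fun p _ => ?_
    have hAp : (fun a => Finset.univ.biUnion A ∩ A (p a)) = fun a => A (p a) := by
      funext a
      exact Finset.inter_eq_right.2 (Finset.subset_biUnion_of_mem A (Finset.mem_univ _))
    rw [hAp]
    by_cases hp : Function.Injective p
    · simpa [hp] using h p hp
    · simp only [hp, not_false_eq_true, if_true]
      have h1 := boxSum_le_prod hF1 fun a => A (p a)
      simp only [hs, Finset.prod_const, Finset.card_univ, Fintype.card_fin] at h1
      have : 0 ≤ d * (s : ℝ) ^ k := by positivity
      linarith
  rw [Finset.sum_add_distrib, ← Finset.sum_filter, Finset.sum_const, Finset.sum_const,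
    Finset.card_univ, Fintype.card_fun, Fintype.card_fin, nsmul_eq_mul, nsmul_eq_mul] at hle
  have hni := card_filter_not_injective_le Fintype.card_pos hθ
  have := mul_le_mul_of_nonneg_right hni (by positivity : (0 : ℝ) ≤ (s : ℝ) ^ k)
  push_cast at hle
  rw [mul_pow]
  linarith

end Partition

/-! ### Edge indicators, the case `j = 1` as box sums, and induced subhypergraphs. -/

namespace UniformHypergraph

section EdgeIndicator

open Classical

variable {V : Type*} {k : ℕ}

/-- The indicator function of the `k`-tuples whose entries form an edge. -/
noncomputable def edgeIndicator (H : UniformHypergraph k V) (v : Fin k → V) : ℝ :=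
  if Finset.univ.image v ∈ H.edges then 1 else 0

theorem edgeIndicator_nonneg (H : UniformHypergraph k V) (v : Fin k → V) :
    0 ≤ H.edgeIndicator v := by
  unfold edgeIndicator
  split_ifs <;> norm_num

theorem edgeIndicator_le_one (H : UniformHypergraph k V) (v : Fin k → V) :
    H.edgeIndicator v ≤ 1 := by
  unfold edgeIndicator
  split_ifs <;> norm_num

theorem boxSum_edgeIndicator (H : UniformHypergraph k V) (B : Fin k → Finset V) :
    boxSum H.edgeIndicator B =
      (({v ∈ Fintype.piFinset B | Finset.univ.image v ∈ H.edges} : Finset _).card : ℝ) := by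
  simp only [boxSum, edgeIndicator, Finset.sum_boole]

theorem boxSum_edgeIndicator_const [Fintype V] (H : UniformHypergraph k V) (U : Finset V) :
    boxSum H.edgeIndicator (fun _ => U) =
      k.factorial * ((Finset.powersetCard k U ∩ H.edges).card : ℝ) := by
  rw [boxSum_edgeIndicator]
  have h := card_filter_image_mem k (Finset.powersetCard k U ∩ H.edges)
    fun s hs => (Finset.mem_powersetCard.1 (Finset.mem_inter.1 hs).1).2
  have e : ({v ∈ Fintype.piFinset fun _ : Fin k => U | Finset.univ.image v ∈ H.edges} : Finset _) =
      ({v | Finset.univ.image v ∈ Finset.powersetCard k U ∩ H.edges} : Finset (Fin k → V)) := by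
    ext v
    simp only [Finset.mem_filter, Fintype.mem_piFinset, Finset.mem_univ, true_and,
      Finset.mem_inter, Finset.mem_powersetCard, Finset.image_subset_iff, forall_const]
    exact ⟨fun ⟨h1, h2⟩ => ⟨⟨h1, H.card_of_mem _ h2⟩, h2⟩, fun ⟨⟨h1, _⟩, h2⟩ => ⟨h1, h2⟩⟩
  rw [e, h]
  push_cast
  rfl

theorem boxSum_edgeIndicator_comp_perm (H : UniformHypergraph k V) (B : Fin k → Finset V)
    (σ : Equiv.Perm (Fin k)) :
    boxSum H.edgeIndicator (fun a => B (σ a)) = boxSum H.edgeIndicator B := by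
  unfold boxSum
  refine Finset.sum_nbij' (fun v a => v (σ.symm a)) (fun v a => v (σ a)) ?_ ?_ ?_ ?_ ?_
  · intro v hv
    rw [Fintype.mem_piFinset] at hv ⊢
    intro a
    simpa using hv (σ.symm a)
  · intro v hv
    rw [Fintype.mem_piFinset] at hv ⊢
    exact fun a => hv (σ a)
  · simp
  · simp
  · intro v _
    have : Finset.univ.image (fun a => v (σ.symm a)) = Finset.univ.image v := by
      ext x
      simp only [Finset.mem_image, Finset.mem_univ, true_and]
      exact ⟨fun ⟨a, ha⟩ => ⟨_, ha⟩, fun ⟨a, ha⟩ => ⟨σ a, by simpa using ha⟩⟩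
    simp only [edgeIndicator, this]

/-- Test density on the `1`-graph formed by the vertices of `U`, whose cliques are the `k`-subsets
of `U`; `θ` pays for tuples with repetitions. -/
theorem IsDense.le_boxSum [Fintype V] {H : UniformHypergraph k V} {d η θ : ℝ} (hd0 : 0 ≤ d)
    (hd1 : d ≤ 1) (h : H.IsDense d η 1) {U : Finset V} (hU : 0 < U.card)
    (hθ : (k : ℝ) ^ 2 ≤ θ * U.card) :
    (d - θ) * (U.card : ℝ) ^ k - k.factorial * η * (Fintype.card V : ℝ) ^ k ≤
      boxSum H.edgeIndicator (fun _ => U) := by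
  have h := h ⟨Finset.powersetCard 1 U, fun e he => (Finset.mem_powersetCard.1 he).2⟩
  have e : cliques ⟨Finset.powersetCard 1 U, fun e he => (Finset.mem_powersetCard.1 he).2⟩ k =
      Finset.powersetCard k U := by
    ext s
    simp only [cliques, Finset.mem_filter, Finset.mem_powersetCard, Finset.subset_univ, true_and]
    rw [and_comm]
    refine and_congr_left fun _ => ⟨fun hs x hx => ?_, fun hs => Finset.powersetCard_mono hs⟩
    have := hs (Finset.mem_powersetCard.2
      ⟨Finset.singleton_subset_iff.2 hx, Finset.card_singleton x⟩)
    exact Finset.singleton_subset_iff.1 (Finset.mem_powersetCard.1 this).1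
  rw [e, Finset.card_powersetCard] at h
  rw [boxSum_edgeIndicator_const]
  have hdf : ((U.card.descFactorial k : ℕ) : ℝ) = k.factorial * (U.card.choose k : ℝ) := by
    rw [Nat.descFactorial_eq_factorial_mul_choose]
    push_cast
    rfl
  have h1 := mul_le_mul_of_nonneg_left h (by positivity : (0 : ℝ) ≤ k.factorial)
  have h2 := pow_sub_descFactorial_le hU hθ
  have h3 : (U.card.descFactorial k : ℝ) ≤ (U.card : ℝ) ^ k := by
    exact_mod_cast Nat.descFactorial_le_pow _ _
  rw [hdf] at h2 h3
  have h4 := mul_le_mul_of_nonneg_left h2 hd0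
  have h5 : d * (θ * (U.card : ℝ) ^ k) ≤ θ * (U.card : ℝ) ^ k :=
    mul_le_of_le_one_left (by linarith) hd1
  linarith

theorem exists_tupleCliques_eq_piFinset [Fintype V]
    (G : (S : Finset.powersetCard 1 (Finset.univ : Finset (Fin k))) → Set (S.1 → V)) :
    ∃ B : Fin k → Finset V, tupleCliques G = Fintype.piFinset B := by
  have hi : ∀ i : Fin k, {i} ∈ Finset.powersetCard 1 (Finset.univ : Finset (Fin k)) := by simp
  refine ⟨fun i => {x | (fun _ => x) ∈ G ⟨{i}, hi i⟩}, ?_⟩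
  ext v
  simp only [tupleCliques, Finset.mem_filter, Finset.mem_univ, true_and, Fintype.mem_piFinset]
  have hr : ∀ i : Fin k, (fun a : ({i} : Finset (Fin k)) => v a) = fun _ => v i := by
    intro i
    funext a
    rw [Finset.mem_singleton.1 a.2]
  constructor
  · intro h i
    have := h ⟨{i}, hi i⟩
    rwa [hr i] at this
  · rintro h ⟨S, hS⟩
    obtain ⟨i, rfl⟩ := Finset.card_eq_one.1 (Finset.mem_powersetCard.1 hS).2
    have := h i
    rwa [← hr i] at this

theorem isFamilyDense_powersetCard_one [Fintype V] {H : UniformHypergraph k V} {d η : ℝ}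
    (h : ∀ B : Fin k → Finset V, d * ∏ a, ((B a).card : ℝ) - η * (Fintype.card V : ℝ) ^ k ≤
      boxSum H.edgeIndicator B) :
    H.IsFamilyDense d η (Finset.powersetCard 1 Finset.univ) := by
  intro G
  obtain ⟨B, hB⟩ := exists_tupleCliques_eq_piFinset G
  have := h B
  rw [boxSum_edgeIndicator] at this
  rw [tupleEdges, hB, Fintype.card_piFinset]
  push_cast
  exact this

/-- The subhypergraph induced on a set `U` of vertices. -/
noncomputable def induce (H : UniformHypergraph k V) (U : Finset V) : UniformHypergraph k U where
  edges := {e | e.map (Function.Embedding.subtype _) ∈ H.edges}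
  card_of_mem := by
    intro e he
    simpa using H.card_of_mem _ (Finset.mem_filter.1 he).2

theorem Free.induce {W : Type*} {F : UniformHypergraph k W} {H : UniformHypergraph k V}
    (h : F.Free H) (U : Finset V) : F.Free (H.induce U) := by
  rintro ⟨f, hf⟩
  refine h ⟨f.trans (Function.Embedding.subtype _), fun e he => ?_⟩
  rw [← Finset.map_map]
  exact (Finset.mem_filter.1 (hf e he)).2

theorem boxSum_edgeIndicator_induce (H : UniformHypergraph k V) (U : Finset V)
    (B : Fin k → Finset U) :
    boxSum (H.induce U).edgeIndicator B =
      boxSum H.edgeIndicator fun a => (B a).map (Function.Embedding.subtype _) := by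
  unfold boxSum
  refine Finset.sum_nbij (fun v a => (v a : V)) ?_ ?_ ?_ ?_
  · intro v hv
    rw [Fintype.mem_piFinset] at hv ⊢
    exact fun a => Finset.mem_map_of_mem (Function.Embedding.subtype _) (hv a)
  · intro v _ w _ hvw
    funext a
    exact Subtype.ext (congrFun hvw a)
  · intro w hw
    rw [Finset.mem_coe, Fintype.mem_piFinset] at hw
    have : ∀ a, ∃ y ∈ B a, (y : V) = w a := fun a => by
      obtain ⟨y, hy, hyw⟩ := Finset.mem_map.1 (hw a)
      exact ⟨y, hy, hyw⟩
    choose v hv hvw using this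
    exact ⟨v, Fintype.mem_piFinset.2 hv, funext hvw⟩
  · intro v _
    simp only [edgeIndicator, UniformHypergraph.induce, Finset.mem_filter, Finset.mem_univ,
      true_and]
    refine if_congr (Iff.of_eq (congrArg (· ∈ H.edges) ?_)) rfl rfl
    ext x
    simp

end EdgeIndicator

end UniformHypergraph

/-! ### Extracting a vertex set that is dense on all boxes. -/

namespace UniformHypergraph

open Classical in
theorem exists_disjoint_family_card_eq (V : Type*) [Fintype V] (R : ℕ) :
    ∃ A : Fin R → Finset V, (∀ i j x, x ∈ A i → x ∈ A j → i = j) ∧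
      ∀ i, (A i).card = Fintype.card V / R := by
  have hcard : Fintype.card (Fin R × Fin (Fintype.card V / R)) ≤ Fintype.card V := by
    simpa using Nat.mul_div_le (Fintype.card V) R
  obtain ⟨φ⟩ := Function.Embedding.nonempty_of_card_le hcard
  refine ⟨fun i => Finset.univ.image fun b => φ (i, b), fun i j x hi hj => ?_, fun i => ?_⟩
  · obtain ⟨a, -, rfl⟩ := Finset.mem_image.1 hi
    obtain ⟨b, -, hb⟩ := Finset.mem_image.1 hj
    exact (congrArg Prod.fst (φ.injective hb)).symm
  · rw [Finset.card_image_of_injective _ fun b b' hb => (Prod.ext_iff.1 (φ.injective hb)).2]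
    simp

theorem card_le_mul_div {n R : ℕ} (hR : 0 < R) (h : 2 * R ≤ n) :
    (n : ℝ) ≤ 2 * R * ((n / R : ℕ) : ℝ) := by
  have h1 := Nat.lt_mul_div_succ n hR
  have h2 : n ≤ 2 * R * (n / R) := by nlinarith
  exact_mod_cast h2

-- Testing regularity on the whole box gives `d - γ ≤ D`; testing it on `B` costs another `γ`.
open Classical in
theorem le_boxSum_of_regular {V : Type*} {k s : ℕ} (hs0 : 0 < s) {F : (Fin k → V) → ℝ}
    {A : Fin k → Finset V} (hs : ∀ a, (A a).card = s) {γ d D : ℝ} (hγ : 0 ≤ γ)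
    (hD : ∀ B : Fin k → Finset V, (∀ a, B a ⊆ A a) →
      |boxSum (fun v => F v - D) B| ≤ γ * (s : ℝ) ^ k)
    (hd : d * (s : ℝ) ^ k ≤ boxSum F A) {B : Fin k → Finset V} (hB : ∀ a, B a ⊆ A a) :
    d * ∏ a, ((B a).card : ℝ) - 2 * γ * (s : ℝ) ^ k ≤ boxSum F B := by
  have hsk : (0 : ℝ) < (s : ℝ) ^ k := by positivity
  have h1 := (abs_le.1 (hD A fun _ => subset_rfl)).2
  have h2 := (abs_le.1 (hD B hB)).1
  rw [boxSum_sub_const] at h1 h2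
  simp only [hs, Finset.prod_const, Finset.card_univ, Fintype.card_fin] at h1
  have hdD : d - γ ≤ D := by
    refine le_of_mul_le_mul_right ?_ hsk
    linarith
  have hP0 : 0 ≤ ∏ a, ((B a).card : ℝ) := Finset.prod_nonneg fun _ _ => Nat.cast_nonneg _
  have hP : ∏ a, ((B a).card : ℝ) ≤ (s : ℝ) ^ k := by
    have : ∏ a, ((B a).card : ℝ) ≤ ∏ _a : Fin k, (s : ℝ) :=
      Finset.prod_le_prod (fun _ _ => Nat.cast_nonneg _) fun a _ =>
        Nat.cast_le.2 (hs a ▸ Finset.card_le_card (hB a))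
    simpa using this
  nlinarith [mul_le_mul_of_nonneg_right hdD hP0, mul_le_mul_of_nonneg_left hP hγ]

-- The indicator is symmetric, so the density depends only on the set of parts. This lets Ramsey's
-- theorem be applied to unordered sets of parts.
open Classical in
theorem boxSum_edgeIndicator_congr_range {V ι : Type*} {k : ℕ} (H : UniformHypergraph k V)
    (A : ι → Finset V) {p q : Fin k → ι} (hp : Function.Injective p) (hq : Function.Injective q)
    (hpq : Set.range p = Set.range q) :
    boxSum H.edgeIndicator (fun a => A (p a)) = boxSum H.edgeIndicator (fun a => A (q a)) := by
  let σ : Equiv.Perm (Fin k) :=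
    ((Equiv.ofInjective p hp).trans (Equiv.setCongr hpq)).trans (Equiv.ofInjective q hq).symm
  have hσ : ∀ a, q (σ a) = p a := fun a => by
    simp only [σ, Equiv.trans_apply]
    rw [Equiv.apply_ofInjective_symm hq]
    rfl
  rw [← boxSum_edgeIndicator_comp_perm H (fun a => A (q a)) σ]
  simp only [hσ]

open Classical in
set_option maxHeartbeats 1000000 in
/-- A large hypergraph that is dense with respect to all vertex sets contains a large set of
vertices that is dense with respect to all `k`-tuples of its subsets. -/
theorem exists_subset_le_boxSum (k n₀ : ℕ) {d ε η₀ : ℝ} (hd1 : d ≤ 1) (hε : 0 < ε) (hεd : ε ≤ d)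
    (hη₀ : 0 < η₀) :
    ∃ η : ℝ, 0 < η ∧ ∃ N : ℕ, ∀ {V : Type} [Fintype V] (H : UniformHypergraph k V),
      H.IsDense d η 1 → N ≤ Fintype.card V → ∃ U : Finset V, n₀ ≤ U.card ∧
        ∀ B : Fin k → Finset V, (∀ a, B a ⊆ U) →
          (d - ε) * ∏ a, ((B a).card : ℝ) - η₀ * (U.card : ℝ) ^ k ≤ boxSum H.edgeIndicator B := by
  -- In the dense case the error is `2 * (η₀ / 4) + θ ≤ η₀`. In the sparse case the density is at
  -- most `d - ε + θ` and at least `d - θ - ε / 4`, which is contradictory for `θ ≤ ε / 4`.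
  set θ : ℝ := min (ε / 4) (η₀ / 2) with hθ
  have hθ0 : 0 < θ := by positivity
  have hθε : θ ≤ ε / 4 := min_le_left _ _
  have hθη : θ ≤ η₀ / 2 := min_le_right _ _
  clear_value θ
  obtain ⟨t₀, ht₀⟩ := exists_nat_ge ((k : ℝ) ^ 2 / θ)
  obtain ⟨t, ht, ht0⟩ : ∃ t : ℕ, (k : ℝ) ^ 2 ≤ θ * t ∧ 0 < t := by
    refine ⟨t₀ + 1, ?_, by omega⟩
    rw [div_le_iff₀ hθ0] at ht₀
    push_cast
    linarith
  obtain ⟨R₀, hR₀⟩ := exists_monochromatic_subset k t t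
  obtain ⟨R, hR, hRR⟩ : ∃ R : ℕ, 0 < R ∧ R₀ ≤ R := ⟨R₀ + 1, by omega, by omega⟩
  have hR' : (0 : ℝ) < R := by exact_mod_cast hR
  obtain ⟨c, hc, hreg⟩ := exists_regular_subfamily (Fin k) (Finset.univ : Finset (Fin k ↪ Fin R))
    (γ := η₀ / 4) (by positivity)
  have hf : (0 : ℝ) < k.factorial := by exact_mod_cast k.factorial_pos
  obtain ⟨N, hN⟩ := exists_nat_ge (2 * R * (n₀ + 1) / c)
  -- The parts end with at least `c / (2 * R) * n` vertices, so this `η` costs at most `ε / 4`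
  -- relative to the union; `2 * R ≤ n` bounds the rounding loss in `n / R`.
  refine ⟨ε / 4 * (c / (2 * R)) ^ k / k.factorial, by positivity, max (2 * R) N,
    fun {V} _ H hH hV => ?_⟩
  obtain ⟨A₀, hA₀, hA₀c⟩ := exists_disjoint_family_card_eq V R
  obtain ⟨s, A, hs, hAA, hAs, hA⟩ := hreg H.edgeIndicator H.edgeIndicator_nonneg
    H.edgeIndicator_le_one _ A₀ hA₀c
  simp only [Fintype.card_fin, Finset.mem_univ, true_implies] at hA
  set n := Fintype.card V
  have hAd : ∀ i j x, x ∈ A i → x ∈ A j → i = j := fun i j x hi hj =>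
    hA₀ i j x (hAA i hi) (hAA j hj)
  have hns : c / (2 * R) * n ≤ s := by
    refine le_trans ?_ hs
    rw [div_mul_eq_mul_div, div_le_iff₀ (by positivity)]
    have := mul_le_mul_of_nonneg_left
      (card_le_mul_div hR ((le_max_left _ _).trans hV)) hc.le
    linarith
  have hsn₀ : n₀ + 1 ≤ s := by
    have h1 : (N : ℝ) ≤ n := by exact_mod_cast (le_max_right _ _).trans hV
    have h2 := hN.trans h1
    rw [div_le_iff₀ hc] at h2
    have h3 : ((n₀ : ℝ) + 1) ≤ s := by
      refine le_trans ?_ hns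
      rw [div_mul_eq_mul_div, le_div_iff₀ (by positivity)]
      linarith
    exact_mod_cast h3
  have hs0 : 0 < s := by omega
  have hcardU : ∀ T : Finset (Fin R), T.card = t →
      (Finset.univ.biUnion fun i : T => A i).card = t * s := by
    intro T hT
    rw [Finset.card_biUnion]
    · simp [hAs, hT]
    · intro i _ j _ hij
      refine Finset.disjoint_left.2 ?_
      exact fun x hi hj => hij (Subtype.ext (hAd _ _ x hi hj))
  have hts : s ≤ t * s := Nat.le_mul_of_pos_left s ht0
  obtain ⟨T, -, hTt, hT⟩ | ⟨T, -, hTt, hT⟩ := hR₀ (Finset.univ : Finset (Fin R))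
    (by simpa using hRR) fun I => ∀ p : Fin k → Fin R, Function.Injective p →
      Finset.univ.image p = I →
        (d - ε) * (s : ℝ) ^ k ≤ boxSum H.edgeIndicator fun a => A (p a)
  all_goals
    have hTcard : Fintype.card T = t := by rw [Fintype.card_coe, hTt]
    have : Nonempty T := Fintype.card_pos_iff.1 (hTcard ▸ ht0)
    have hTd : ∀ (i j : T) x, x ∈ A i → x ∈ A j → i = j := fun i j x hi hj =>
      Subtype.ext (hAd _ _ x hi hj)
    have hpT : ∀ p : Fin k → T, Function.Injective p →
        Function.Injective (fun a => (p a : Fin R)) ∧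
          Finset.univ.image (fun a => (p a : Fin R)) ⊆ T ∧
          (Finset.univ.image (fun a => (p a : Fin R))).card = k := by
      intro p hp
      have hinj : Function.Injective (fun a => (p a : Fin R)) := Subtype.val_injective.comp hp
      refine ⟨hinj, Finset.image_subset_iff.2 fun a _ => (p a).2, ?_⟩
      rw [Finset.card_image_of_injective _ hinj, Finset.card_univ, Fintype.card_fin]
  · refine ⟨Finset.univ.biUnion fun i : T => A i, ?_, fun B hB => ?_⟩
    · rw [hcardU T hTt]
      omega
    · rw [hcardU T hTt]
      have h := le_boxSum_of_injective H.edgeIndicator_nonneg (A := fun i : T => A i) hTd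
        (fun i => hAs i) (d := d - ε) (δ := 2 * (η₀ / 4)) (θ := θ) (by linarith) (by positivity)
        (by rwa [hTcard]) (fun p hp B hB => by
          obtain ⟨h1, h2, h3⟩ := hpT p hp
          obtain ⟨D, hD⟩ := hA ⟨_, h1⟩
          exact le_boxSum_of_regular hs0 (fun a => hAs _) (by positivity) hD
            (hT _ h2 h3 _ h1 rfl) hB) hB
      rw [hTcard] at h
      refine le_trans ?_ h
      push_cast
      have : 0 ≤ ((t : ℝ) * s) ^ k := by positivity
      nlinarith
  · exfalso
    have hup := boxSum_biUnion_le H.edgeIndicator_le_one (A := fun i : T => A i) hTd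
      (fun i => hAs i) (d := d - ε) (θ := θ) (by linarith) (by rwa [hTcard]) fun p hp => by
        obtain ⟨h1, h2, h3⟩ := hpT p hp
        have := hT _ h2 h3
        push Not at this
        obtain ⟨q, hq, hqp, hlt⟩ := this
        rw [boxSum_edgeIndicator_congr_range H A h1 hq]
        · exact hlt.le
        · have := congrArg (fun I : Finset (Fin R) => (I : Set (Fin R))) hqp
          simpa using this.symm
    have hlow := hH.le_boxSum (θ := θ) (by linarith) hd1
      (U := Finset.univ.biUnion fun i : T => A i) (by rw [hcardU T hTt]; positivity) (by
        rw [hcardU T hTt]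
        refine ht.trans ?_
        gcongr
        exact Nat.le_mul_of_pos_right t hs0)
    rw [hTcard] at hup
    rw [hcardU T hTt] at hlow
    push_cast at hlow
    have herr : k.factorial * (ε / 4 * (c / (2 * R)) ^ k / k.factorial) * (n : ℝ) ^ k ≤
        ε / 4 * ((t : ℝ) * s) ^ k := by
      calc _ = ε / 4 * (c / (2 * R) * n) ^ k := by
            rw [mul_pow, mul_div_cancel₀ _ hf.ne']
            ring
        _ ≤ ε / 4 * ((t : ℝ) * s) ^ k := by
            refine mul_le_mul_of_nonneg_left (pow_le_pow_left₀ (by positivity) ?_ k) (by positivity)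
            exact hns.trans (le_of_le_of_eq (Nat.cast_le.2 hts) (Nat.cast_mul t s))
    have hpos : 0 < ((t : ℝ) * s) ^ k := by positivity
    nlinarith

theorem IsFamilyDense.mono {V : Type*} [Fintype V] {k : ℕ} {H : UniformHypergraph k V}
    {d d' η η' : ℝ} {𝒮 : Finset (Finset (Fin k))} (h : H.IsFamilyDense d η 𝒮) (hd : d' ≤ d)
    (hη : η ≤ η') : H.IsFamilyDense d' η' 𝒮 := by
  intro G
  refine le_trans ?_ (h G)
  gcongr

end UniformHypergraph

/-! ### Equality of the two densities. -/

theorem proposition2p5 {V : Type*} [Fintype V] (k j : ℕ) (hj : 1 ≤ j) (hjk : j < k)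
    (F : UniformHypergraph k V) :
    F.turanDensity j = F.familyTuranDensity (Finset.powersetCard j (Finset.univ : Finset (Fin k))) := by
  unfold UniformHypergraph.turanDensity UniformHypergraph.familyTuranDensity
  set X : Set ℝ := {d : ℝ | d ∈ Set.Icc (0 : ℝ) 1 ∧ ∀ η : ℝ, 0 < η → ∀ n : ℕ,
    ∃ (W : Type) (_ : Fintype W) (H : UniformHypergraph k W),
      F.Free H ∧ H.IsDense d η j ∧ n ≤ Fintype.card W} with hX
  set Y : Set ℝ := {d : ℝ | d ∈ Set.Icc (0 : ℝ) 1 ∧ ∀ η : ℝ, 0 < η → ∀ n : ℕ,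
    ∃ (W : Type) (_ : Fintype W) (H : UniformHypergraph k W),
      F.Free H ∧ H.IsFamilyDense d η (Finset.powersetCard j (Finset.univ : Finset (Fin k))) ∧
        n ≤ Fintype.card W} with hY
  have hYX : Y ⊆ X := by
    rintro d ⟨hd, h⟩
    refine ⟨hd, fun η hη n => ?_⟩
    obtain ⟨W, _, H, h1, h2, h3⟩ := h η hη n
    exact ⟨W, _, H, h1, h2.isDense hd.1 hη.le, h3⟩
  have hXb : BddAbove X := ⟨1, fun d hd => hd.1.2⟩
  have hYb : BddAbove Y := hXb.mono hYX
  have hXY : ∀ d ∈ X, ∀ ε : ℝ, 0 < ε → ε ≤ d → d - ε ∈ Y := by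
    rintro d ⟨hd, h⟩ ε hε hεd
    refine ⟨⟨by linarith, by linarith [hd.2]⟩, fun η hη n => ?_⟩
    rcases hj.eq_or_lt with rfl | hj
    · obtain ⟨η', hη', N, hN⟩ :=
        UniformHypergraph.exists_subset_le_boxSum k n hd.2 hε hεd hη
      obtain ⟨W, _, H, h1, h2, h3⟩ := h η' hη' N
      obtain ⟨U, hU, hUB⟩ := hN H h2 h3
      refine ⟨U, inferInstance, H.induce U, h1.induce U,
        UniformHypergraph.isFamilyDense_powersetCard_one fun B => ?_, by simpa using hU⟩
      rw [UniformHypergraph.boxSum_edgeIndicator_induce]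
      simpa using hUB (fun a => (B a).map (Function.Embedding.subtype _))
        fun a => Finset.map_subtype_subset _
    · have hk : (0 : ℝ) < (k : ℝ) ^ k := by
        have : 0 < k := by omega
        positivity
      obtain ⟨N, hN⟩ := exists_nat_ge ((k : ℝ) ^ 2 / (η / 2))
      -- Averaging over colourings multiplies the error by `k ^ k`, giving `η / 2`; repeated entries
      -- cost the other half.
      obtain ⟨W, _, H, h1, h2, h3⟩ := h (η / 2 / k ^ k) (by positivity) (max n (N + 1))
      have hNW : N + 1 ≤ Fintype.card W := (le_max_right _ _).trans h3
      refine ⟨W, _, H, h1, (h2.isFamilyDense (θ := η / 2) hj hjk.le hd.1 hd.2 (by omega)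
        ?_).mono (by linarith) (le_of_eq ?_), (le_max_left _ _).trans h3⟩
      · rw [div_le_iff₀ (by positivity)] at hN
        have : (N : ℝ) ≤ Fintype.card W := by exact_mod_cast (by omega : N ≤ Fintype.card W)
        nlinarith
      · rw [mul_div_cancel₀ _ hk.ne']
        ring
  rcases X.eq_empty_or_nonempty with hX0 | hX0
  · rw [Set.subset_eq_empty hYX hX0, hX0]
  · refine le_antisymm (csSup_le hX0 fun d hd => ?_) ?_
    · refine le_of_forall_pos_le_add fun ε hε => ?_
      rcases le_or_gt ε d with h | h
      · linarith [le_csSup hYb (hXY d hd ε hε h)]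
      -- When `d < ε`, nonnegativity of the supremum suffices, even if `Y` is empty.
      · have : 0 ≤ sSup Y := Real.sSup_nonneg fun y hy => hy.1.1
        linarith
    · rcases Y.eq_empty_or_nonempty with hY0 | hY0
      · rw [hY0, Real.sSup_empty]
        exact Real.sSup_nonneg fun y hy => hy.1.1
      · exact csSup_le_csSup hXb hY0 hYX
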